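/- \textbf{Theorem.} Consider a normal-form game with players $i\in[n]$, finite action sets $\mathcal A_i$ and cost functions $c_i:\prod_j\mathcal A_j\to\mathbb R$. Let $\Delta(\mathcal A_i)\subset\mathbb R^{\mathcal A_i}$ be the probability simplex, $\Delta^n=\prod_i\Delta(\mathcal A_i)$, and let $C_i(x)=\sum_{a}\big(\prod_j x_j(a_j)\big)c_i(a)$ be the expected cost. Assume that it is a potential game: there is $\Phi:\Delta^n\to\mathbb R$ with $$C_i(x_i',x_{-i})-C_i(x)=\Phi(x_i',x_{-i})-\Phi(x)\qquad\text{for all } i,\ x\in\Delta^n,\ x_i'\in\Delta(\mathcal A_i).$$ Each player $i$ has $d_i\ge 0$ private constraints $g_{i,m}(x_i)\le 0$, $m\in[d_i]$, where every $g_{i,m}$ is convex on $\Delta(\mathcal A_i)$ and $\gamma$-smooth there for some $\gamma>0$ (differentiable at the points of the simplex, with $\gamma$-Lipschitz gradient on it). Slater's condition holds: for each $i$ there is one $\tilde x_i\in\Delta(\mathcal A_i)$ with $g_{i,m}(\tilde x_i)<0$ for all $m\in[d_i]$. Algorithm IGD with regularization $\mu>0$ starts at an arbitrary $x^{(0)}\in\Delta^n$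 and iterates, for $t=0,1,2,\dots$, $$\lambda^{(t)}=\operatorname*{argmax}_{\lambda\ge 0}\Big(\sum_{i,m}\lambda_{i,m}\,g_{i,m}(x_i^{(t)})-\mu\|\lambda\|_2^2\Big),$$ $$x_i^{(t+1)}=\Pi_{\Delta(\mathcal A_i)}\Big(x_i^{(t)}-\eta\Big(\nabla_{x_i}C_i(x^{(t)})+\sum_{m}\lambda^{(t)}_{i,m}\nabla g_{i,m}(x_i^{(t)})\Big)\Big)\quad\text{for all players } i,$$ where $\Pi$ is the Euclidean projection and the step size is $$\eta=\frac{\mu}{4\big((nA_{\max})^2+(\Lambda_{\max}\gamma)^2\big)},\qquad A_{\max}=\max_i|\mathcal A_i|,\quad \Lambda_{\max}=\frac{\sqrt d\,G_{\max}}{2\mu},\quad d=\sum_i d_i,\quad G_{\max}=\max_{i,m}\max_{y\in\Delta(\mathcal A_i)}g_{i,m}(y)$$ (with $G_{\max}=0$ if there are no constraints). Then for all constants $0<a\le b$ there are $K,\varepsilon_0>0$, depending only on the game, the constraints, $\gamma$, $a$ and $b$, such that for every $\varepsilon\in(0,\varepsilon_0]$ there is $T\in\mathbb N$ with $T\le K/\varepsilon^6$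 for which the following holds. For every $\mu\in[a\varepsilon,b\varepsilon]$ and every run of IGD, some iterate $x^{(t)}$ with $1\le t\le T$ is an $O(\varepsilon)$-approximate feasible $O(\varepsilon)$-approximate Nash equilibrium, that is, $x^{(t)}\in\Delta^n$, $g_{i,m}(x_i^{(t)})\le K\varepsilon$ for all $i,m$, and $$C_i(x_i',x_{-i}^{(t)})\ge C_i(x^{(t)})-K\varepsilon$$ for every player $i$ and every $x_i'\in\Delta(\mathcal A_i)$ with $g_{i,m}(x_i')\le\varepsilon$ for all $m\in[d_i]$. -/

import Mathlib

noncomputable section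

namespace ConstrainedPotentialGame

/-- The probability simplex `Δ(α)`, inside `ℝ^α` with the Euclidean norm. -/
def simplex (α : Type*) [Fintype α] : Set (EuclideanSpace ℝ α) :=
  {x | (∀ a, 0 ≤ x a) ∧ ∑ a, x a = 1}

/-- Joint vectors `(x_1, …, x_n)` with `x_i ∈ ℝ^{A_i}`. -/
abbrev Profile {n : ℕ} (A : Fin n → Type*) : Type _ := ∀ i, EuclideanSpace ℝ (A i)

/-- The product of simplices `Δ^n`: joint mixed strategy profiles. -/
def mixedProfiles {n : ℕ} (A : Fin n → Type*) [∀ i, Fintype (A i)] : Set (Profile A) :=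
  {x | ∀ i, x i ∈ simplex (A i)}

/-- Multipliers `λ = (λ_1, …, λ_n)` with `λ_i ∈ ℝ^{d_i}`. -/
abbrev Multiplier {n : ℕ} (d : Fin n → ℕ) : Type := ∀ i, EuclideanSpace ℝ (Fin (d i))

section

variable {n : ℕ} {A : Fin n → Type*} [∀ i, Fintype (A i)] {d : Fin n → ℕ}

/-- Expected cost of the profile `x` for the cost function `c` on pure action profiles:
`∑_a (∏_j x_j(a_j)) c(a)`. -/
def expectedCost (c : (∀ i, A i) → ℝ) (x : Profile A) : ℝ :=
  ∑ a : ∀ i, A i, (∏ j, x j (a j)) * c a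

/-- `Φ` is a potential function of the game with costs `c`: every unilateral change of a mixed
strategy changes the deviating player's expected cost and `Φ` by the same amount. -/
def IsPotential (c : Fin n → (∀ i, A i) → ℝ) (Φ : Profile A → ℝ) : Prop :=
  ∀ x ∈ mixedProfiles A, ∀ i, ∀ y ∈ simplex (A i),
    expectedCost (c i) (Function.update x i y) - expectedCost (c i) x
      = Φ (Function.update x i y) - Φ x

/-- `f` is `γ`-smooth on the simplex: differentiable at its points, with `γ`-Lipschitz gradient. -/
def IsSmoothOnSimplex {α : Type*} [Fintype α] (γ : ℝ) (f : EuclideanSpace ℝ α → ℝ) : Prop :=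
  (∀ x ∈ simplex α, DifferentiableAt ℝ f x) ∧
    ∀ x ∈ simplex α, ∀ y ∈ simplex α, ‖gradient f x - gradient f y‖ ≤ γ * ‖x - y‖

/-- Slater's condition: every player has a strategy which satisfies all of the player's
constraints strictly, with margins `ξ_m < 0`. -/
def Slater (g : ∀ i, Fin (d i) → EuclideanSpace ℝ (A i) → ℝ) : Prop :=
  ∀ i, ∃ y ∈ simplex (A i), ∃ ξ : Fin (d i) → ℝ, ∀ m, ξ m < 0 ∧ g i m y < ξ m

/-- The `λ`-dependent part `λᵀ g(x) - μ ‖λ‖²` of the regularized Lagrangian. -/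
def multiplierObjective (g : ∀ i, Fin (d i) → EuclideanSpace ℝ (A i) → ℝ) (μ : ℝ)
    (x : Profile A) (lam : Multiplier d) : ℝ :=
  (∑ i, ∑ m, lam i m * g i m (x i)) - μ * ∑ i, ‖lam i‖ ^ 2

/-- The cone `λ ≥ 0` of admissible multipliers. -/
def nonnegMultipliers (d : Fin n → ℕ) : Set (Multiplier d) :=
  {lam | ∀ i m, 0 ≤ lam i m}

/-- `p` is the Euclidean projection of `z` onto the set `S`. -/
def IsProjection {E : Type*} [NormedAddCommGroup E] (S : Set E) (z p : E) : Prop :=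
  p ∈ S ∧ ∀ y ∈ S, ‖z - p‖ ≤ ‖z - y‖

/-- `∇_{x_i} C_i(x) + λ_iᵀ ∇_{x_i} g_i(x_i)`, the direction used by player `i`. -/
def playerGradient (c : Fin n → (∀ i, A i) → ℝ)
    (g : ∀ i, Fin (d i) → EuclideanSpace ℝ (A i) → ℝ)
    (x : Profile A) (lam : Multiplier d) (i : Fin n) : EuclideanSpace ℝ (A i) :=
  gradient (fun y => expectedCost (c i) (Function.update x i y)) (x i)
    + ∑ m, lam i m • gradient (g i m) (x i)

/-- `(x^(t), λ^(t))` is generated by Algorithm IGD with regularization `μ` and step size `η`: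
`x^(0) ∈ Δ^n` is arbitrary, `λ^(t)` maximizes `λᵀ g(x^(t)) - μ‖λ‖²` over `λ ≥ 0`, and every player
independently makes a projected gradient step. -/
structure IsIGDRun (c : Fin n → (∀ i, A i) → ℝ)
    (g : ∀ i, Fin (d i) → EuclideanSpace ℝ (A i) → ℝ) (μ η : ℝ)
    (x : ℕ → Profile A) (lam : ℕ → Multiplier d) : Prop where
  init : x 0 ∈ mixedProfiles A
  lam_mem : ∀ t, lam t ∈ nonnegMultipliers d
  lam_max : ∀ t, IsMaxOn (multiplierObjective g μ (x t)) (nonnegMultipliers d) (lam t)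
  step : ∀ t i, IsProjection (simplex (A i))
    (x t i - η • playerGradient c g (x t) (lam t) i) (x (t + 1) i)

/-- `G_max`, the maximum of all constraint functions over the simplices. -/
def constraintMax (g : ∀ i, Fin (d i) → EuclideanSpace ℝ (A i) → ℝ) : ℝ :=
  sSup {r | ∃ i m, ∃ y ∈ simplex (A i), g i m y = r}

/-- `Λ_max = √d G_max / (2 μ)`, where `d` is the total number of constraints. -/
def multiplierBound (g : ∀ i, Fin (d i) → EuclideanSpace ℝ (A i) → ℝ) (μ : ℝ) : ℝ :=
  Real.sqrt (∑ i, (d i : ℝ)) * constraintMax g / (2 * μ)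

/-- `A_max`, the largest number of actions of a player. -/
def maxActions (A : Fin n → Type*) [∀ i, Fintype (A i)] : ℕ :=
  Finset.univ.sup fun i => Fintype.card (A i)

/-- The step size `η = μ / (4 ((n A_max)² + (Λ_max γ)²))`. -/
def stepSize (g : ∀ i, Fin (d i) → EuclideanSpace ℝ (A i) → ℝ) (γ μ : ℝ) : ℝ :=
  μ / (4 * (((n : ℝ) * maxActions A) ^ 2 + (multiplierBound g μ * γ) ^ 2))

/-- `x` is an approximately feasible approximate Nash equilibrium: it is a mixed strategy profile
which violates each constraint by at most `δ`, and no player lowers the expected cost by more than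
`δ` through a unilateral deviation to a mixed strategy violating the player's constraints by at
most `ε`. -/
def IsApproxFeasibleApproxNash (c : Fin n → (∀ i, A i) → ℝ)
    (g : ∀ i, Fin (d i) → EuclideanSpace ℝ (A i) → ℝ) (ε δ : ℝ) (x : Profile A) : Prop :=
  x ∈ mixedProfiles A ∧ (∀ i m, g i m (x i) ≤ δ) ∧
    ∀ i, ∀ y ∈ simplex (A i), (∀ m, g i m y ≤ ε) →
      expectedCost (c i) x - δ ≤ expectedCost (c i) (Function.update x i y)

end

end ConstrainedPotentialGame

end

/-!
Maximizing the regularized Lagrangian over `λ ≥ 0` gives `λ_{i,m} = max (g_{i,m}(x_i), 0) / (2 μ)`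
(`multiplier_eq_of_isMaxOn`). Hence the simultaneous steps of the players form one projected
gradient step for the penalized potential `Ψ = Φ + (1 / 4μ) ∑ max (g_{i,m}(x_i), 0)²`.

The potential is multilinear up to a constant, so changing the strategies of the players one at a
time shows that it has bounded curvature (`IsPotential.sub_le`). The penalty has curvature of order
`1 / μ`, by first-order convexity of the constraints (`exists_penalty_le_add`). The step size `η`
is of order `μ³` if some constraint can be violated and at most `μ / 4` otherwise, in which case the
penalty vanishes on the simplices. Either way `η` lies below the inverse curvature of `Ψ` once `μ`
is small (`exists_stepSize_mul_le`), and each step decreases `η Ψ` by at least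
`‖x^(t+1) - x^(t)‖² / 2` (`IsIGDRun.descent`). The oscillation of `Ψ` is of order `1 / μ` and `η` is
at least of order `μ³`, so among the first `O(ε⁻⁶)` steps with `t ≥ 1` there is one of length at
most `η ε`. Its starting point is `O(ε)`-stationary for `Ψ` (`IsProjection.neg_le_inner`).

At a stationary point, the direction towards a Slater point bounds the multipliers by a constant
(`sum_multiplier_le`). Therefore `max (g_{i,m}(x_i), 0) = 2 μ λ_{i,m} = O(ε)`, and by convexity a
deviation with `g_{i,m} ≤ ε` gains at most `O(ε) + ε ∑ λ_{i,m}` (`expectedCost_sub_le_update`).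
-/

namespace ConstrainedPotentialGame

open Finset

/-! ### The simplex, projections and first-order convexity -/

section Simplex

variable {α : Type*} [Fintype α]

lemma convex_simplex : Convex ℝ (simplex α) := by
  rintro x ⟨hx, hx'⟩ y ⟨hy, hy'⟩ s t hs ht hst
  refine ⟨fun a => ?_, ?_⟩
  · have := mul_nonneg hs (hx a)
    have := mul_nonneg ht (hy a)
    simpa using by linarith
  · simp [sum_add_distrib, ← mul_sum, hx', hy', hst]

lemma le_one_of_mem_simplex {x : EuclideanSpace ℝ α} (hx : x ∈ simplex α) (a : α) : x a ≤ 1 := by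
  rw [← hx.2]
  exact single_le_sum (f := fun a => x a) (fun b _ => hx.1 b) (mem_univ a)

lemma norm_le_one_of_mem_simplex {x : EuclideanSpace ℝ α} (hx : x ∈ simplex α) : ‖x‖ ≤ 1 := by
  have h : ‖x‖ ^ 2 ≤ 1 := by
    rw [EuclideanSpace.real_norm_sq_eq, ← hx.2]
    refine sum_le_sum fun a _ => ?_
    nlinarith [hx.1 a, le_one_of_mem_simplex hx a]
  nlinarith [norm_nonneg x]

lemma norm_sub_le_two {x y : EuclideanSpace ℝ α} (hx : x ∈ simplex α) (hy : y ∈ simplex α) :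
    ‖x - y‖ ≤ 2 := by
  linarith [norm_sub_le x y, norm_le_one_of_mem_simplex hx, norm_le_one_of_mem_simplex hy]

end Simplex

/-- Variational inequality of the Euclidean projection onto a convex set. -/
lemma IsProjection.inner_le_zero {E : Type*} [NormedAddCommGroup E] [InnerProductSpace ℝ E]
    {S : Set E} {z p : E} (hS : Convex ℝ S) (h : IsProjection S z p) {y : E} (hy : y ∈ S) :
    inner ℝ (z - p) (y - p) ≤ 0 := by
  have : Nonempty S := ⟨⟨p, h.1⟩⟩
  refine (norm_eq_iInf_iff_real_inner_le_zero hS h.1).1 (le_antisymm ?_ ?_) y hy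
  · exact le_ciInf fun w => h.2 w w.2
  · exact ciInf_le ⟨0, by rintro _ ⟨w, rfl⟩; exact norm_nonneg _⟩ (⟨p, h.1⟩ : S)

/-- A convex function lies above its linearization at a point of differentiability. -/
lemma inner_gradient_le_sub {E : Type*} [NormedAddCommGroup E] [InnerProductSpace ℝ E]
    [CompleteSpace E] {S : Set E} {f : E → ℝ} (hf : ConvexOn ℝ S f) {x y : E} (hx : x ∈ S)
    (hy : y ∈ S) (hd : DifferentiableAt ℝ f x) :
    inner ℝ (gradient f x) (y - x) ≤ f y - f x := by
  rw [inner_gradient_left]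
  have h := (hd.hasFDerivAt.hasLineDerivAt (y - x)).tendsto_slope_zero_right
  refine le_of_tendsto h ?_
  filter_upwards [Ioo_mem_nhdsGT (zero_lt_one' ℝ)] with t ht
  have hc := hf.2 hx hy (sub_nonneg.2 ht.2.le) ht.1.le (by ring)
  have he : (1 - t) • x + t • y = x + t • (y - x) := by module
  rw [he] at hc
  simp only [smul_eq_mul] at hc ⊢
  rw [inv_mul_le_iff₀ ht.1]
  linarith

/-! ### Smooth convex constraints -/

section Constraint

variable {α : Type*} [Fintype α] {γ : ℝ} {f : EuclideanSpace ℝ α → ℝ}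

/-- The gradient of a smooth function is bounded on the simplex. -/
lemma IsSmoothOnSimplex.exists_gradient_bound (h : IsSmoothOnSimplex γ f) (hγ : 0 < γ) :
    ∃ B : ℝ, 0 ≤ B ∧ ∀ x ∈ simplex α, ‖gradient f x‖ ≤ B := by
  rcases (simplex α).eq_empty_or_nonempty with he | ⟨z, hz⟩
  · exact ⟨0, le_rfl, by simp [he]⟩
  · refine ⟨‖gradient f z‖ + γ * 2, by positivity, fun x hx => ?_⟩
    have h1 := h.2 x hx z hz
    have h2 := mul_le_mul_of_nonneg_left (norm_sub_le_two hx hz) hγ.le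
    have h3 := norm_sub_norm_le (gradient f x) (gradient f z)
    linarith

/-- Convexity bounds a difference of values by the gradients at the two end points. -/
lemma abs_sub_le_of_gradient_bound (hf : ConvexOn ℝ (simplex α) f) (h : IsSmoothOnSimplex γ f)
    {B : ℝ} (hB : ∀ x ∈ simplex α, ‖gradient f x‖ ≤ B) {x y : EuclideanSpace ℝ α}
    (hx : x ∈ simplex α) (hy : y ∈ simplex α) : |f y - f x| ≤ B * ‖y - x‖ := by
  have key : ∀ u ∈ simplex α, ∀ v ∈ simplex α, f u - f v ≤ B * ‖v - u‖ := by
    intro u hu v hv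
    have h1 := inner_gradient_le_sub hf hu hv (h.1 u hu)
    have h2 := (abs_le.1 (abs_real_inner_le_norm (gradient f u) (v - u))).1
    have h3 := mul_le_mul_of_nonneg_right (hB u hu) (norm_nonneg (v - u))
    linarith
  rw [abs_le]
  have h1 := key x hx y hy
  have h2 := key y hy x hx
  rw [norm_sub_rev] at h2
  constructor <;> linarith

/-- Quadratic upper bound for a smooth convex function. -/
lemma sub_le_inner_gradient_add (hf : ConvexOn ℝ (simplex α) f) (h : IsSmoothOnSimplex γ f)
    {x y : EuclideanSpace ℝ α} (hx : x ∈ simplex α) (hy : y ∈ simplex α) :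
    f y - f x ≤ inner ℝ (gradient f x) (y - x) + γ * ‖y - x‖ ^ 2 := by
  -- Convexity at the far end point `y` replaces an integration of the gradient along `[x, y]`.
  have h1 := inner_gradient_le_sub hf hy hx (h.1 y hy)
  have h2 := real_inner_le_norm (gradient f y - gradient f x) (y - x)
  have h3 := mul_le_mul_of_nonneg_right (h.2 y hy x hx) (norm_nonneg (y - x))
  rw [inner_sub_left] at h2
  rw [← neg_sub y x, inner_neg_right] at h1
  nlinarith

lemma sq_max_zero_le (s t : ℝ) :
    max t 0 ^ 2 ≤ max s 0 ^ 2 + 2 * max s 0 * (t - s) + (t - s) ^ 2 := by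
  rcases max_cases s 0 with ⟨h, h'⟩ | ⟨h, h'⟩ <;> rcases max_cases t 0 with ⟨k, k'⟩ | ⟨k, k'⟩ <;>
    rw [h, k] <;> nlinarith

/-- Quadratic upper bound for the squared violation of a constraint. -/
lemma sq_max_zero_le_of_smooth (hf : ConvexOn ℝ (simplex α) f) (h : IsSmoothOnSimplex γ f)
    (hγ : 0 < γ) {B G : ℝ} (hB : ∀ x ∈ simplex α, ‖gradient f x‖ ≤ B)
    (hG : ∀ x ∈ simplex α, max (f x) 0 ≤ G)
    {x y : EuclideanSpace ℝ α} (hx : x ∈ simplex α) (hy : y ∈ simplex α) :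
    max (f y) 0 ^ 2 ≤ max (f x) 0 ^ 2 + 2 * (max (f x) 0 * inner ℝ (gradient f x) (y - x))
      + (2 * G * γ + B ^ 2) * ‖y - x‖ ^ 2 := by
  have h0 := le_max_right (f x) 0
  have h1 := sq_max_zero_le (f x) (f y)
  have h2 := mul_le_mul_of_nonneg_left (sub_le_inner_gradient_add hf h hx hy) h0
  have h3 := mul_le_mul_of_nonneg_right (hG x hx)
    (show 0 ≤ γ * ‖y - x‖ ^ 2 by positivity)
  have h4 : (f y - f x) ^ 2 ≤ (B * ‖y - x‖) ^ 2 :=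
    sq_le_sq' (neg_le_of_abs_le (abs_sub_le_of_gradient_bound hf h hB hx hy))
      (le_of_abs_le (abs_sub_le_of_gradient_bound hf h hB hx hy))
  nlinarith

end Constraint

/-! ### Expected costs and the potential -/

section Game

variable {n : ℕ} {A : Fin n → Type*} [∀ i, Fintype (A i)]

/-- The expected cost as a function of the strategy of player `i` alone, the other strategies
being those of `x`; it is linear on the whole of `ℝ^{A_i}`. -/
noncomputable def deviationCost (c : (∀ i, A i) → ℝ) (x : Profile A) (i : Fin n) :
    EuclideanSpace ℝ (A i) →ₗ[ℝ] ℝ :=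
  ∑ a : ∀ i, A i, ((∏ j ∈ univ.erase i, x j (a j)) * c a) • (EuclideanSpace.proj (a i)).toLinearMap

lemma deviationCost_apply (c : (∀ i, A i) → ℝ) (x : Profile A) (i : Fin n)
    (v : EuclideanSpace ℝ (A i)) :
    deviationCost c x i v = ∑ a : ∀ i, A i, (∏ j ∈ univ.erase i, x j (a j)) * c a * v (a i) := by
  simp [deviationCost]

lemma expectedCost_update (c : (∀ i, A i) → ℝ) (x : Profile A) (i : Fin n)
    (v : EuclideanSpace ℝ (A i)) :
    expectedCost c (Function.update x i v) = deviationCost c x i v := by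
  rw [expectedCost, deviationCost_apply]
  refine sum_congr rfl fun a _ => ?_
  rw [← mul_prod_erase univ _ (mem_univ i), Function.update_self]
  have : ∏ j ∈ univ.erase i, Function.update x i v j (a j) = ∏ j ∈ univ.erase i, x j (a j) :=
    prod_congr rfl fun j hj => by rw [Function.update_of_ne (ne_of_mem_erase hj)]
  rw [this]
  ring

lemma expectedCost_eq (c : (∀ i, A i) → ℝ) (x : Profile A) (i : Fin n) :
    expectedCost c x = deviationCost c x i (x i) := by
  rw [← expectedCost_update, Function.update_eq_self]

lemma inner_gradient_expectedCost (c : (∀ i, A i) → ℝ) (x : Profile A) (i : Fin n)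
    (v : EuclideanSpace ℝ (A i)) :
    inner ℝ (gradient (fun y => expectedCost c (Function.update x i y)) (x i)) v
      = deviationCost c x i v := by
  have h : (fun y => expectedCost c (Function.update x i y))
      = LinearMap.toContinuousLinearMap (deviationCost c x i) := by
    ext y; simp [expectedCost_update]
  rw [inner_gradient_left, h, ContinuousLinearMap.fderiv]
  rfl

/-- The sum of the absolute values of all entries of the cost tables. -/
noncomputable def totalCost (c : Fin n → (∀ i, A i) → ℝ) : ℝ := ∑ i, ∑ a, |c i a|

lemma totalCost_nonneg (c : Fin n → (∀ i, A i) → ℝ) : 0 ≤ totalCost c :=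
  sum_nonneg fun _ _ => sum_nonneg fun _ _ => abs_nonneg _

lemma sum_abs_le_totalCost (c : Fin n → (∀ i, A i) → ℝ) (i : Fin n) :
    ∑ a, |c i a| ≤ totalCost c :=
  single_le_sum (f := fun i => ∑ a, |c i a|) (fun _ _ => sum_nonneg fun _ _ => abs_nonneg _)
    (mem_univ i)

lemma abs_prod_le_one {x : Profile A} (hx : x ∈ mixedProfiles A) (s : Finset (Fin n))
    (a : ∀ i, A i) : |∏ j ∈ s, x j (a j)| ≤ 1 := by
  rw [abs_of_nonneg (prod_nonneg fun j _ => (hx j).1 _)]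
  exact prod_le_one (fun j _ => (hx j).1 _) fun j _ => le_one_of_mem_simplex (hx j) _

lemma abs_prod_sub_prod_le {x z : Profile A} (hx : x ∈ mixedProfiles A) (hz : z ∈ mixedProfiles A)
    (s : Finset (Fin n)) (a : ∀ i, A i) :
    |∏ j ∈ s, x j (a j) - ∏ j ∈ s, z j (a j)| ≤ ∑ j ∈ s, ‖x j - z j‖ := by
  induction s using Finset.induction_on with
  | empty => simp
  | insert i s hi ih =>
    rw [prod_insert hi, prod_insert hi, sum_insert hi]
    have he : x i (a i) * ∏ j ∈ s, x j (a j) - z i (a i) * ∏ j ∈ s, z j (a j)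
        = (x i - z i) (a i) * ∏ j ∈ s, x j (a j)
          + z i (a i) * (∏ j ∈ s, x j (a j) - ∏ j ∈ s, z j (a j)) := by
      rw [PiLp.sub_apply]; ring
    rw [he]
    refine (abs_add_le _ _).trans (add_le_add ?_ ?_)
    · rw [abs_mul]
      have h1 : |(x i - z i) (a i)| ≤ ‖x i - z i‖ := PiLp.norm_apply_le (x i - z i) (a i)
      calc _ ≤ ‖x i - z i‖ * 1 := mul_le_mul h1 (abs_prod_le_one hx s a) (abs_nonneg _)
            (norm_nonneg _)
        _ = _ := mul_one _
    · rw [abs_mul, abs_of_nonneg ((hz i).1 _)]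
      exact (mul_le_of_le_one_left (abs_nonneg _) (le_one_of_mem_simplex (hz i) _)).trans ih

lemma abs_deviationCost_le (c : Fin n → (∀ i, A i) → ℝ) {x : Profile A}
    (hx : x ∈ mixedProfiles A) (i : Fin n) (v : EuclideanSpace ℝ (A i)) :
    |deviationCost (c i) x i v| ≤ totalCost c * ‖v‖ := by
  rw [deviationCost_apply]
  refine (abs_sum_le_sum_abs _ _).trans (le_trans ?_
    (mul_le_mul_of_nonneg_right (sum_abs_le_totalCost c i) (norm_nonneg v)))
  rw [sum_mul]
  refine sum_le_sum fun a _ => ?_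
  rw [abs_mul, abs_mul]
  exact mul_le_mul (mul_le_of_le_one_left (abs_nonneg _) (abs_prod_le_one hx _ a))
    (PiLp.norm_apply_le v (a i)) (abs_nonneg _) (abs_nonneg _)

/-- The gradient of a player's cost is Lipschitz in the strategies of the other players. -/
lemma abs_deviationCost_sub_le (c : Fin n → (∀ i, A i) → ℝ) {x z : Profile A}
    (hx : x ∈ mixedProfiles A) (hz : z ∈ mixedProfiles A) (i : Fin n)
    (v : EuclideanSpace ℝ (A i)) :
    |deviationCost (c i) x i v - deviationCost (c i) z i v|
      ≤ totalCost c * (∑ j, ‖x j - z j‖) * ‖v‖ := by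
  have h0 : 0 ≤ ∑ j, ‖x j - z j‖ := sum_nonneg fun _ _ => norm_nonneg _
  rw [deviationCost_apply, deviationCost_apply, ← sum_sub_distrib]
  refine (abs_sum_le_sum_abs _ _).trans (le_trans ?_ (mul_le_mul_of_nonneg_right
    (mul_le_mul_of_nonneg_right (sum_abs_le_totalCost c i) h0) (norm_nonneg v)))
  rw [sum_mul, sum_mul]
  refine sum_le_sum fun a _ => ?_
  have hp : |∏ j ∈ univ.erase i, x j (a j) - ∏ j ∈ univ.erase i, z j (a j)|
      ≤ ∑ j, ‖x j - z j‖ :=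
    (abs_prod_sub_prod_le hx hz _ a).trans
      (sum_le_sum_of_subset_of_nonneg (subset_univ _) fun _ _ _ => norm_nonneg _)
  rw [← sub_mul, ← sub_mul, abs_mul, abs_mul, mul_comm |c i a|]
  exact mul_le_mul (mul_le_mul_of_nonneg_right hp (abs_nonneg _)) (PiLp.norm_apply_le v (a i))
    (abs_nonneg _) (by positivity)

/-- Quadratic upper bound for the potential. The players are switched from `x` to `y` one at a
time; each switch changes the potential by a value of the linear map `deviationCost`. -/
lemma IsPotential.sub_le {c : Fin n → (∀ i, A i) → ℝ} {Φ : Profile A → ℝ} (hΦ : IsPotential c Φ)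
    {x y : Profile A} (hx : x ∈ mixedProfiles A) (hy : y ∈ mixedProfiles A) :
    Φ y - Φ x ≤ ∑ i, deviationCost (c i) x i (y i - x i)
      + totalCost c * n * ∑ i, ‖y i - x i‖ ^ 2 := by
  set D := ∑ i, ‖y i - x i‖ with hD
  have hmix : ∀ s : Finset (Fin n), s.piecewise y x ∈ mixedProfiles A := fun s i => by
    by_cases h : i ∈ s
    · rw [piecewise_eq_of_mem _ _ _ h]; exact hy i
    · rw [piecewise_eq_of_notMem _ _ _ h]; exact hx i
  have key : ∀ s : Finset (Fin n), Φ (s.piecewise y x) - Φ x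
      ≤ ∑ i ∈ s, (deviationCost (c i) x i (y i - x i) + totalCost c * D * ‖y i - x i‖) := by
    intro s
    induction s using Finset.induction_on with
    | empty => simp
    | insert i s hi ih =>
      have h1 := hΦ _ (hmix s) i (y i) (hy i)
      rw [← piecewise_insert, expectedCost_eq (c i) (s.piecewise y x) i, piecewise_insert,
        expectedCost_update, piecewise_eq_of_notMem _ _ _ hi, ← map_sub, ← piecewise_insert] at h1
      have h2 := (le_abs_self _).trans
        (abs_deviationCost_sub_le c (hmix s) hx i (y i - x i))
      have h3 : ∑ j, ‖s.piecewise y x j - x j‖ ≤ D := by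
        refine sum_le_sum fun j _ => ?_
        by_cases h : j ∈ s
        · rw [piecewise_eq_of_mem _ _ _ h]
        · rw [piecewise_eq_of_notMem _ _ _ h]; simp
      have h4 := mul_le_mul_of_nonneg_right
        (mul_le_mul_of_nonneg_left h3 (totalCost_nonneg c)) (norm_nonneg (y i - x i))
      rw [sum_insert hi]
      linarith
  have h1 := key univ
  rw [piecewise_univ, sum_add_distrib, ← mul_sum, ← hD, mul_assoc] at h1
  have h2 : D * D ≤ n * ∑ i, ‖y i - x i‖ ^ 2 := by
    have := sq_sum_le_card_mul_sum_sq (s := (univ : Finset (Fin n))) (f := fun i => ‖y i - x i‖)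
    rw [card_univ, Fintype.card_fin] at this
    rwa [← sq]
  have h3 := mul_le_mul_of_nonneg_left h2 (totalCost_nonneg c)
  rw [← mul_assoc _ (n : ℝ)] at h3
  linarith

/-- The potential is bounded on the strategy profiles. -/
lemma IsPotential.exists_sub_le {c : Fin n → (∀ i, A i) → ℝ} {Φ : Profile A → ℝ}
    (hΦ : IsPotential c Φ) :
    ∃ R : ℝ, 0 ≤ R ∧ ∀ x ∈ mixedProfiles A, ∀ y ∈ mixedProfiles A, Φ y - Φ x ≤ R := by
  have hB := totalCost_nonneg c
  refine ⟨∑ _i : Fin n, totalCost c * 2 + totalCost c * n * ∑ _i : Fin n, 2 ^ 2, by positivity,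
    fun x hx y hy => (hΦ.sub_le hx hy).trans (add_le_add (sum_le_sum fun i _ => ?_) ?_)⟩
  · exact (le_of_abs_le (abs_deviationCost_le c hx i _)).trans
      (mul_le_mul_of_nonneg_left (norm_sub_le_two (hy i) (hx i)) hB)
  · refine mul_le_mul_of_nonneg_left (sum_le_sum fun i _ => ?_) (by positivity)
    exact pow_le_pow_left₀ (norm_nonneg _) (norm_sub_le_two (hy i) (hx i)) 2

end Game

/-! ### Multipliers and the penalty function -/

section Penalty

variable {n : ℕ} {A : Fin n → Type*} {d : Fin n → ℕ}
  {g : ∀ i, Fin (d i) → EuclideanSpace ℝ (A i) → ℝ}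

/-- The maximizer of the regularized Lagrangian in `λ ≥ 0` is `λ = max (g(x), 0) / (2 μ)`. -/
lemma multiplier_eq_of_isMaxOn {μ : ℝ} (hμ : 0 < μ) {x : Profile A} {lam : Multiplier d}
    (hlam : lam ∈ nonnegMultipliers d)
    (hmax : IsMaxOn (multiplierObjective g μ x) (nonnegMultipliers d) lam)
    (i : Fin n) (m : Fin (d i)) : lam i m = max (g i m (x i)) 0 / (2 * μ) := by
  have hobj : ∀ l : Multiplier d, multiplierObjective g μ x l
      = ∑ i, ∑ m, (l i m * g i m (x i) - μ * l i m ^ 2) := fun l => by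
    simp only [multiplierObjective, EuclideanSpace.real_norm_sq_eq, mul_sum, sum_sub_distrib]
  set opt : Multiplier d := fun i => WithLp.toLp 2 fun m => max (g i m (x i)) 0 / (2 * μ)
    with hopt
  have hopt_mem : opt ∈ nonnegMultipliers d := fun i m =>
    div_nonneg (le_max_right _ _) (by positivity)
  -- The objective is `2 μ`-strongly concave, so a maximizer has distance zero from `opt`.
  have hgap : ∀ i m, μ * (lam i m - opt i m) ^ 2 ≤ (opt i m * g i m (x i) - μ * opt i m ^ 2)
      - (lam i m * g i m (x i) - μ * lam i m ^ 2) := by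
    intro i m
    have h0 := hlam i m
    have ho : opt i m = max (g i m (x i)) 0 / (2 * μ) := rfl
    rcases le_total (g i m (x i)) 0 with h | h
    · rw [ho, max_eq_right h]
      have := mul_nonneg h0 (neg_nonneg.2 h)
      simp only [zero_div]
      linarith
    · rw [max_eq_left h] at ho
      have hg : g i m (x i) = 2 * μ * opt i m := by rw [ho]; field_simp
      rw [hg]
      exact le_of_eq (by ring)
  have hle := hmax hopt_mem
  simp only [Set.mem_ofPred_eq, hobj] at hle
  have hsum : ∑ i, ∑ m, μ * (lam i m - opt i m) ^ 2 ≤ 0 := by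
    refine (sum_le_sum fun i _ => sum_le_sum fun m _ => hgap i m).trans ?_
    simp only [sum_sub_distrib] at hle ⊢
    linarith
  have hterm : μ * (lam i m - opt i m) ^ 2 ≤ ∑ i, ∑ m, μ * (lam i m - opt i m) ^ 2 :=
    (single_le_sum (f := fun m => μ * (lam i m - opt i m) ^ 2) (fun _ _ => by positivity)
      (mem_univ m)).trans
      (single_le_sum (f := fun i => ∑ m, μ * (lam i m - opt i m) ^ 2)
        (fun _ _ => sum_nonneg fun _ _ => by positivity) (mem_univ i))
  have hz : (lam i m - opt i m) ^ 2 = 0 := by nlinarith [sq_nonneg (lam i m - opt i m)]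
  exact sub_eq_zero.1 (pow_eq_zero_iff two_ne_zero |>.1 hz)

/-- The sum of the squared constraint violations. -/
noncomputable def penalty (g : ∀ i, Fin (d i) → EuclideanSpace ℝ (A i) → ℝ) (x : Profile A) : ℝ :=
  ∑ i, ∑ m, max (g i m (x i)) 0 ^ 2

lemma penalty_nonneg (x : Profile A) : 0 ≤ penalty g x :=
  sum_nonneg fun _ _ => sum_nonneg fun _ _ => by positivity

variable [∀ i, Fintype (A i)]

lemma penalty_le {G : ℝ} (hG : ∀ i m, ∀ y ∈ simplex (A i), max (g i m y) 0 ≤ G) {x : Profile A}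
    (hx : x ∈ mixedProfiles A) : penalty g x ≤ ∑ i, ∑ _m : Fin (d i), G ^ 2 :=
  sum_le_sum fun i _ => sum_le_sum fun m _ =>
    pow_le_pow_left₀ (le_max_right _ _) (hG i m _ (hx i)) 2

/-- Quadratic upper bound for the penalty. The curvature can be taken to be zero when no constraint
is ever violated. -/
lemma exists_penalty_le_add {γ G B : ℝ} (hγ : 0 < γ)
    (hconv : ∀ i m, ConvexOn ℝ (simplex (A i)) (g i m))
    (hsmooth : ∀ i m, IsSmoothOnSimplex γ (g i m))
    (hB : ∀ i m, ∀ y ∈ simplex (A i), ‖gradient (g i m) y‖ ≤ B)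
    (hG0 : 0 ≤ G) (hG : ∀ i m, ∀ y ∈ simplex (A i), max (g i m y) 0 ≤ G) :
    ∃ Q : ℝ, 0 ≤ Q ∧ (G = 0 → Q = 0) ∧ ∀ x ∈ mixedProfiles A, ∀ y ∈ mixedProfiles A,
      penalty g y ≤ penalty g x
        + 2 * ∑ i, ∑ m, max (g i m (x i)) 0 * inner ℝ (gradient (g i m) (x i)) (y i - x i)
        + Q * ∑ i, ‖y i - x i‖ ^ 2 := by
  rcases hG0.eq_or_lt with h0 | h0
  · subst h0
    refine ⟨0, le_rfl, fun _ => rfl, fun x hx y hy => ?_⟩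
    have h1 : ∀ i m, max (g i m (x i)) 0 = 0 := fun i m =>
      le_antisymm (hG i m _ (hx i)) (le_max_right _ _)
    have h2 : ∀ i m, max (g i m (y i)) 0 = 0 := fun i m =>
      le_antisymm (hG i m _ (hy i)) (le_max_right _ _)
    simp [penalty, h1, h2]
  · have hq : 0 ≤ 2 * G * γ + B ^ 2 := by positivity
    refine ⟨(2 * G * γ + B ^ 2) * ∑ i, (d i : ℝ), by positivity, fun h => absurd h h0.ne',
      fun x hx y hy => ?_⟩
    have h1 : penalty g y ≤ ∑ i, ∑ m, (max (g i m (x i)) 0 ^ 2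
        + 2 * (max (g i m (x i)) 0 * inner ℝ (gradient (g i m) (x i)) (y i - x i))
        + (2 * G * γ + B ^ 2) * ‖y i - x i‖ ^ 2) :=
      sum_le_sum fun i _ => sum_le_sum fun m _ =>
        sq_max_zero_le_of_smooth (hconv i m) (hsmooth i m) hγ (hB i m) (hG i m) (hx i) (hy i)
    refine h1.trans ?_
    simp only [sum_add_distrib, ← mul_sum, penalty]
    rw [mul_assoc (2 * G * γ + B ^ 2)]
    refine add_le_add le_rfl (mul_le_mul_of_nonneg_left ?_ hq)
    simp only [sum_const, card_univ, Fintype.card_fin, nsmul_eq_mul]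
    rw [sum_mul]
    refine sum_le_sum fun i _ => ?_
    gcongr
    exact single_le_sum (f := fun i => ‖y i - x i‖ ^ 2) (fun _ _ => by positivity) (mem_univ i)

lemma inner_playerGradient (c : Fin n → (∀ i, A i) → ℝ) (x : Profile A) (lam : Multiplier d)
    (i : Fin n) (v : EuclideanSpace ℝ (A i)) :
    inner ℝ (playerGradient c g x lam i) v
      = deviationCost (c i) x i v + ∑ m, lam i m * inner ℝ (gradient (g i m) (x i)) v := by
  rw [playerGradient, inner_add_left, inner_gradient_expectedCost, sum_inner]
  simp only [real_inner_smul_left]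

/-- Slater's condition with a margin common to all players and constraints. -/
lemma Slater.exists_margin (h : Slater g) :
    ∃ ξ : ℝ, 0 < ξ ∧ ∀ i, ∃ y ∈ simplex (A i), ∀ m, g i m y ≤ -ξ := by
  choose y hy ζ hζ using h
  have : ∀ᶠ ξ in nhdsWithin (0 : ℝ) (Set.Ioi 0), ∀ i, ∀ m, g i m (y i) < -ξ := by
    rw [Filter.eventually_all]
    intro i
    rw [Filter.eventually_all]
    intro m
    have h0 : g i m (y i) < 0 := (hζ i m).2.trans (hζ i m).1
    filter_upwards [Ioo_mem_nhdsGT (neg_pos.2 h0)] with ξ hξ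
    linarith [hξ.2]
  obtain ⟨ξ, hξ, hpos⟩ := (this.and self_mem_nhdsWithin).exists
  exact ⟨ξ, hpos, fun i => ⟨y i, hy i, fun m => (hξ i m).le⟩⟩

end Penalty

/-! ### The step size -/

section StepSize

variable {n : ℕ} {A : Fin n → Type*} [∀ i, Fintype (A i)] {d : Fin n → ℕ}
  {g : ∀ i, Fin (d i) → EuclideanSpace ℝ (A i) → ℝ}

lemma one_le_mul_maxActions [∀ i, Nonempty (A i)] (hn : 0 < n) :
    1 ≤ (n : ℝ) * maxActions A := by
  have h : 1 ≤ maxActions A :=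
    (Fintype.card_pos (α := A ⟨0, hn⟩)).trans_le
      (le_sup (f := fun i => Fintype.card (A i)) (mem_univ _))
  exact_mod_cast Nat.mul_pos hn h

lemma stepSize_pos {γ μ : ℝ} (hμ : 0 < μ) (hN : 1 ≤ (n : ℝ) * maxActions A) :
    0 < stepSize g γ μ := by
  unfold stepSize; positivity

lemma stepSize_le {γ μ : ℝ} (hμ : 0 < μ) (hN : 1 ≤ (n : ℝ) * maxActions A) :
    stepSize g γ μ ≤ μ / 4 := by
  unfold stepSize
  gcongr
  nlinarith [sq_nonneg (multiplierBound g μ * γ)]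

lemma stepSize_eq {γ μ : ℝ} (hμ : 0 < μ) :
    stepSize g γ μ = μ ^ 3 / (4 * (((n : ℝ) * maxActions A) ^ 2 * μ ^ 2
      + (Real.sqrt (∑ i, (d i : ℝ)) * constraintMax g * γ / 2) ^ 2)) := by
  have h : ((n : ℝ) * maxActions A) ^ 2 * μ ^ 2
      + (Real.sqrt (∑ i, (d i : ℝ)) * constraintMax g * γ / 2) ^ 2
      = (((n : ℝ) * maxActions A) ^ 2 + (multiplierBound g μ * γ) ^ 2) * μ ^ 2 := by
    unfold multiplierBound; field_simp
  rw [h, stepSize, ← mul_assoc, show μ ^ 3 = μ * μ ^ 2 by ring,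
    mul_div_mul_right _ _ (by positivity)]

lemma exists_mul_pow_le_stepSize (γ : ℝ) (hN : 1 ≤ (n : ℝ) * maxActions A) :
    ∃ κ : ℝ, 0 < κ ∧ ∀ μ : ℝ, 0 < μ → μ ≤ 1 → κ * μ ^ 3 ≤ stepSize g γ μ := by
  refine ⟨1 / (4 * (((n : ℝ) * maxActions A) ^ 2
      + (Real.sqrt (∑ i, (d i : ℝ)) * constraintMax g * γ / 2) ^ 2)), by positivity,
    fun μ hμ hμ1 => ?_⟩
  rw [stepSize_eq hμ, one_div_mul_eq_div]
  gcongr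
  exact mul_le_of_le_one_right (by positivity) (pow_le_one₀ hμ.le hμ1)

/-- For small `μ` the step size lies below the inverse of the curvature `H + Q / μ` of the
penalized potential. If some constraint can be violated, the step size is of order `μ ^ 3`;
otherwise it is at most `μ / 4` and there is no term `Q / μ`. -/
lemma exists_stepSize_mul_le {γ H Q : ℝ} (hγ : 0 < γ) (hH : 0 ≤ H) (hQ : 0 ≤ Q)
    (hN : 1 ≤ (n : ℝ) * maxActions A)
    (hcase : Q = 0 ∨ 0 < Real.sqrt (∑ i, (d i : ℝ)) * constraintMax g) :
    ∃ μ₀ : ℝ, 0 < μ₀ ∧ μ₀ ≤ 1 ∧ ∀ μ : ℝ, 0 < μ → μ ≤ μ₀ →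
      stepSize g γ μ * (H + Q / μ) ≤ 1 / 2 := by
  obtain ⟨κ, hκ, h⟩ : ∃ κ : ℝ, 0 ≤ κ ∧ ∀ μ : ℝ, 0 < μ → μ ≤ 1 →
      stepSize g γ μ * (H + Q / μ) ≤ κ * μ := by
    rcases hcase with rfl | hS
    · refine ⟨H, hH, fun μ hμ _ => ?_⟩
      have := mul_le_mul_of_nonneg_right (stepSize_le (g := g) (γ := γ) hμ hN) hH
      rw [zero_div, add_zero]
      nlinarith [mul_nonneg hμ.le hH]
    · set S := Real.sqrt (∑ i, (d i : ℝ)) * constraintMax g * γ / 2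
      have hS' : 0 < S := by positivity
      refine ⟨(H + Q) / (4 * S ^ 2), by positivity, fun μ hμ hμ1 => ?_⟩
      have h1 : stepSize g γ μ ≤ μ ^ 3 / (4 * S ^ 2) := by
        rw [stepSize_eq hμ]
        gcongr
        exact le_add_of_nonneg_left (by positivity)
      have h2 : μ * (H + Q / μ) ≤ H + Q := by
        rw [mul_add, mul_div_cancel₀ _ hμ.ne']
        nlinarith
      calc stepSize g γ μ * (H + Q / μ) ≤ μ ^ 3 / (4 * S ^ 2) * (H + Q / μ) := by gcongr
        _ = μ ^ 2 / (4 * S ^ 2) * (μ * (H + Q / μ)) := by ring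
        _ ≤ μ / (4 * S ^ 2) * (H + Q) := by
          gcongr
          nlinarith
        _ = (H + Q) / (4 * S ^ 2) * μ := by ring
  refine ⟨min 1 (1 / (2 * (κ + 1))), by positivity, min_le_left _ _, fun μ hμ hle => ?_⟩
  refine (h μ hμ (hle.trans (min_le_left _ _))).trans ?_
  have h1 := (le_div_iff₀ (by positivity)).1 (hle.trans (min_le_right _ _))
  nlinarith

end StepSize

/-! ### Approximately stationary points are approximate equilibria -/

section Equilibrium

variable {n : ℕ} {A : Fin n → Type*} [∀ i, Fintype (A i)] {d : Fin n → ℕ}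
  {c : Fin n → (∀ i, A i) → ℝ} {g : ∀ i, Fin (d i) → EuclideanSpace ℝ (A i) → ℝ}

/-- At an approximately stationary point of the penalized potential, testing stationarity in the
direction of a Slater point bounds the multipliers of a player. -/
lemma sum_multiplier_le {x : Profile A} (hx : x ∈ mixedProfiles A) {lam : Multiplier d} {i : Fin n}
    {δ ξ : ℝ} (hξ : 0 < ξ) (hconv : ∀ m, ConvexOn ℝ (simplex (A i)) (g i m))
    (hdiff : ∀ m, DifferentiableAt ℝ (g i m) (x i))
    (hlam : ∀ m, 0 ≤ lam i m) (hcompl : ∀ m, 0 ≤ lam i m * g i m (x i))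
    {y : EuclideanSpace ℝ (A i)} (hy : y ∈ simplex (A i)) (hgy : ∀ m, g i m y ≤ -ξ)
    (hstat : -δ ≤ inner ℝ (playerGradient c g x lam i) (y - x i)) :
    ∑ m, lam i m ≤ (totalCost c * 2 + δ) / ξ := by
  rw [inner_playerGradient] at hstat
  have h1 := (le_of_abs_le (abs_deviationCost_le c hx i (y - x i))).trans
    (mul_le_mul_of_nonneg_left (norm_sub_le_two hy (hx i)) (totalCost_nonneg c))
  have h2 : ∑ m, lam i m * inner ℝ (gradient (g i m) (x i)) (y - x i)
      ≤ ∑ m, lam i m * -ξ := by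
    refine sum_le_sum fun m _ => ?_
    have h3 := mul_le_mul_of_nonneg_left
      (inner_gradient_le_sub (hconv m) (hx i) hy (hdiff m)) (hlam m)
    have h4 := mul_le_mul_of_nonneg_left (hgy m) (hlam m)
    linarith [hcompl m]
  rw [← sum_mul] at h2
  rw [le_div_iff₀ hξ]
  linarith

/-- At an approximately stationary point a deviation to an `ε`-feasible strategy gains at most
the stationarity error plus `ε` times the sum of the multipliers. -/
lemma expectedCost_sub_le_update {x : Profile A} (hx : x ∈ mixedProfiles A) {lam : Multiplier d}
    {i : Fin n} {δ ε : ℝ} (hconv : ∀ m, ConvexOn ℝ (simplex (A i)) (g i m))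
    (hdiff : ∀ m, DifferentiableAt ℝ (g i m) (x i))
    (hlam : ∀ m, 0 ≤ lam i m) (hcompl : ∀ m, 0 ≤ lam i m * g i m (x i))
    {y : EuclideanSpace ℝ (A i)} (hy : y ∈ simplex (A i)) (hgy : ∀ m, g i m y ≤ ε)
    (hstat : -δ ≤ inner ℝ (playerGradient c g x lam i) (y - x i)) :
    expectedCost (c i) x - (δ + (∑ m, lam i m) * ε)
      ≤ expectedCost (c i) (Function.update x i y) := by
  rw [inner_playerGradient, map_sub, ← expectedCost_eq, ← expectedCost_update] at hstat
  have h2 : ∑ m, lam i m * inner ℝ (gradient (g i m) (x i)) (y - x i)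
      ≤ ∑ m, lam i m * ε := by
    refine sum_le_sum fun m _ => ?_
    have h3 := mul_le_mul_of_nonneg_left
      (inner_gradient_le_sub (hconv m) (hx i) hy (hdiff m)) (hlam m)
    have h4 := mul_le_mul_of_nonneg_left (hgy m) (hlam m)
    linarith [hcompl m]
  rw [← sum_mul] at h2
  linarith

end Equilibrium

/-! ### Descent and approximate stationarity along a run -/

section Descent

lemma IsProjection.inner_step_le {E : Type*} [NormedAddCommGroup E] [InnerProductSpace ℝ E]
    {S : Set E} (hS : Convex ℝ S) {x G p v : E} {η : ℝ} (h : IsProjection S (x - η • G) p)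
    (hv : v ∈ S) : inner ℝ (x - p) (v - p) ≤ η * inner ℝ G (v - p) := by
  have h1 := h.inner_le_zero hS hv
  rw [sub_right_comm, inner_sub_left, real_inner_smul_left] at h1
  linarith

/-- A short projected gradient step makes the point it starts from approximately stationary. -/
lemma IsProjection.neg_le_inner {α : Type*} [Fintype α] {x G p v : EuclideanSpace ℝ α}
    {η κ ε : ℝ} (hη : 0 < η) (hκ : 0 ≤ κ) (hG : ∀ w, η * |inner ℝ G w| ≤ κ * ‖w‖)
    (h : IsProjection (simplex α) (x - η • G) p) (hshort : ‖p - x‖ ≤ η * ε) (hv : v ∈ simplex α) :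
    -((2 + κ) * ε) ≤ inner ℝ G (v - x) := by
  have h1 := h.inner_step_le convex_simplex hv
  have h2 := (abs_le.1 (abs_real_inner_le_norm (x - p) (v - p))).1
  have h3 : ‖x - p‖ * ‖v - p‖ ≤ η * ε * 2 := by
    rw [norm_sub_rev]
    exact mul_le_mul hshort (norm_sub_le_two hv h.1) (norm_nonneg _)
      ((norm_nonneg _).trans hshort)
  have h4 := mul_le_mul_of_nonneg_left (neg_le_of_abs_le (le_refl |inner ℝ G (p - x)|)) hη.le
  have h5 := (hG (p - x)).trans (mul_le_mul_of_nonneg_left hshort hκ)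
  have h6 : inner ℝ G (v - x) = inner ℝ G (v - p) + inner ℝ G (p - x) := by
    rw [← inner_add_right, sub_add_sub_cancel]
  have h7 : η * -((2 + κ) * ε) ≤ η * inner ℝ G (v - x) := by
    rw [h6]; linarith
  exact le_of_mul_le_mul_left h7 hη

/-- If `Ψ` decreases in step `t` by at least `s t / 2` and by at most `R` in total over the steps
`1, …, T`, one of `s 1, …, s T` is at most `2 R / T`. -/
lemma exists_le_of_descent {Ψ s : ℕ → ℝ} {ρ R : ℝ} {T : ℕ} (hT : 0 < T)
    (hdesc : ∀ t, Ψ (t + 1) + s t / 2 ≤ Ψ t) (hR : Ψ 1 - Ψ (T + 1) ≤ R) (hρ : 2 * R ≤ T * ρ) :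
    ∃ t, 1 ≤ t ∧ t ≤ T ∧ s t ≤ ρ := by
  have hsum : ∑ t ∈ range T, s (t + 1) ≤ ∑ _t ∈ range T, ρ := by
    have h1 : ∑ t ∈ range T, s (t + 1) ≤ ∑ t ∈ range T, 2 * (Ψ (t + 1) - Ψ (t + 1 + 1)) :=
      sum_le_sum fun t _ => by linarith [hdesc (t + 1)]
    rw [← mul_sum, sum_range_sub' (fun t => Ψ (t + 1)), zero_add] at h1
    rw [sum_const, card_range, nsmul_eq_mul]
    linarith
  obtain ⟨t, ht, hle⟩ := exists_le_of_sum_le (nonempty_range_iff.2 hT.ne') hsum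
  exact ⟨t + 1, by omega, mem_range.1 ht, hle⟩

variable {n : ℕ} {A : Fin n → Type*} [∀ i, Fintype (A i)] {d : Fin n → ℕ}
  {c : Fin n → (∀ i, A i) → ℝ} {g : ∀ i, Fin (d i) → EuclideanSpace ℝ (A i) → ℝ}

lemma IsIGDRun.mem_mixedProfiles {μ η : ℝ} {x : ℕ → Profile A} {lam : ℕ → Multiplier d}
    (h : IsIGDRun c g μ η x lam) (t : ℕ) : x t ∈ mixedProfiles A := by
  cases t with
  | zero => exact h.init
  | succ t => exact fun i => (h.step t i).1

/-- The penalized potential decreases along a run whose step size is at most the inverse of twice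
the curvature `totalCost c * n + Q / (4 μ)`. -/
lemma IsIGDRun.descent {μ η Q : ℝ} (hμ : 0 < μ) (hη : 0 < η) {x : ℕ → Profile A}
    {lam : ℕ → Multiplier d} (h : IsIGDRun c g μ η x lam) {Φ : Profile A → ℝ}
    (hΦ : IsPotential c Φ)
    (hQ : ∀ x ∈ mixedProfiles A, ∀ y ∈ mixedProfiles A, penalty g y ≤ penalty g x
        + 2 * ∑ i, ∑ m, max (g i m (x i)) 0 * inner ℝ (gradient (g i m) (x i)) (y i - x i)
        + Q * ∑ i, ‖y i - x i‖ ^ 2)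
    (hstep : η * (totalCost c * n + Q / 4 / μ) ≤ 1 / 2) (t : ℕ) :
    η * (Φ (x (t + 1)) + penalty g (x (t + 1)) / (4 * μ)) + (∑ i, ‖x (t + 1) i - x t i‖ ^ 2) / 2
      ≤ η * (Φ (x t) + penalty g (x t) / (4 * μ)) := by
  have hx := h.mem_mixedProfiles t
  have hy := h.mem_mixedProfiles (t + 1)
  set s := ∑ i, ‖x (t + 1) i - x t i‖ ^ 2 with hs
  have hs0 : 0 ≤ s := sum_nonneg fun _ _ => by positivity
  have h1 := hΦ.sub_le hx hy
  have h2 := hQ _ hx _ hy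
  rw [← hs] at h1 h2
  have h3 : ∑ i, η * inner ℝ (playerGradient c g (x t) (lam t) i) (x (t + 1) i - x t i)
      ≤ ∑ i, -‖x (t + 1) i - x t i‖ ^ 2 := by
    refine sum_le_sum fun i _ => ?_
    have h4 := (h.step t i).inner_step_le convex_simplex (hx i)
    rw [real_inner_self_eq_norm_sq, ← neg_sub (x (t + 1) i), inner_neg_right, norm_neg] at h4
    linarith
  rw [← mul_sum, sum_neg_distrib, ← hs] at h3
  simp only [inner_playerGradient, sum_add_distrib,
    fun i m => multiplier_eq_of_isMaxOn hμ (h.lam_mem t) (h.lam_max t) i m] at h3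
  have h5 : ∑ i, ∑ m, max (g i m (x t i)) 0 / (2 * μ)
        * inner ℝ (gradient (g i m) (x t i)) (x (t + 1) i - x t i)
      = (∑ i, ∑ m, max (g i m (x t i)) 0
        * inner ℝ (gradient (g i m) (x t i)) (x (t + 1) i - x t i)) / (2 * μ) := by
    simp only [sum_div]
    exact sum_congr rfl fun i _ => sum_congr rfl fun m _ => by ring
  rw [h5] at h3
  have h6 := div_le_div_of_nonneg_right h2 (show 0 ≤ 4 * μ by positivity)
  have h7 : ∀ p w : ℝ, (p + 2 * w + Q * s) / (4 * μ) = p / (4 * μ) + w / (2 * μ) + Q / 4 / μ * s :=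
    fun p w => by field_simp; ring
  rw [h7] at h6
  have h8 := mul_le_mul_of_nonneg_left (add_le_add h1 h6) hη.le
  have h9 := mul_le_mul_of_nonneg_right hstep hs0
  linarith

/-- The direction of a player's step is of order at most `1 / μ`, so that its product with a step
size which is at most `μ` is bounded. -/
lemma mul_abs_inner_playerGradient_le {μ η B G : ℝ} (hμ : 0 < μ) (hμ1 : μ ≤ 1)
    (hημ : η ≤ μ) (hG0 : 0 ≤ G) (hB : ∀ i m, ∀ y ∈ simplex (A i), ‖gradient (g i m) y‖ ≤ B)
    (hG : ∀ i m, ∀ y ∈ simplex (A i), max (g i m y) 0 ≤ G) {x : Profile A}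
    (hx : x ∈ mixedProfiles A) {lam : Multiplier d}
    (hlam : ∀ i m, lam i m = max (g i m (x i)) 0 / (2 * μ)) (i : Fin n)
    (w : EuclideanSpace ℝ (A i)) :
    η * |inner ℝ (playerGradient c g x lam i) w|
      ≤ (totalCost c + ∑ i, ∑ _m : Fin (d i), G * |B|) * ‖w‖ := by
  have h1 : ∑ m, |lam i m * inner ℝ (gradient (g i m) (x i)) w|
      ≤ (∑ _m : Fin (d i), G * |B|) / μ * ‖w‖ := by
    rw [sum_div, sum_mul]
    refine sum_le_sum fun m _ => ?_
    have h2 := (abs_real_inner_le_norm (gradient (g i m) (x i)) w).trans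
      (mul_le_mul_of_nonneg_right ((hB i m _ (hx i)).trans (le_abs_self B)) (norm_nonneg w))
    have h3 : |lam i m| ≤ G / μ := by
      rw [hlam, abs_of_nonneg (div_nonneg (le_max_right _ _) (by positivity))]
      exact div_le_div₀ hG0 (hG i m _ (hx i)) hμ (by linarith)
    rw [abs_mul]
    refine (mul_le_mul h3 h2 (abs_nonneg _) (by positivity)).trans_eq (by ring)
  have h4 : |inner ℝ (playerGradient c g x lam i) w|
      ≤ totalCost c * ‖w‖ + (∑ _m : Fin (d i), G * |B|) / μ * ‖w‖ := by
    rw [inner_playerGradient]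
    exact (abs_add_le _ _).trans (add_le_add (abs_deviationCost_le c hx i w)
      ((abs_sum_le_sum_abs _ _).trans h1))
  have h5 : ∑ _m : Fin (d i), G * |B| ≤ ∑ i, ∑ _m : Fin (d i), G * |B| :=
    single_le_sum (f := fun i => ∑ _m : Fin (d i), G * |B|) (fun _ _ => by positivity)
      (mem_univ i)
  have hC := totalCost_nonneg c
  have h0 : 0 ≤ ∑ _m : Fin (d i), G * |B| := by positivity
  calc η * |inner ℝ (playerGradient c g x lam i) w|
      ≤ μ * (totalCost c * ‖w‖ + (∑ _m : Fin (d i), G * |B|) / μ * ‖w‖) :=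
        mul_le_mul hημ h4 (abs_nonneg _) hμ.le
    _ = (μ * totalCost c + ∑ _m : Fin (d i), G * |B|) * ‖w‖ := by field_simp
    _ ≤ _ := by
      refine mul_le_mul_of_nonneg_right (add_le_add ?_ h5) (norm_nonneg w)
      exact mul_le_of_le_one_left hC hμ1

end Descent

end ConstrainedPotentialGame

/-! ### Convergence of the algorithm -/

open ConstrainedPotentialGame in
theorem mainTheorem1 {n : ℕ} {A : Fin n → Type*} [∀ i, Fintype (A i)] {d : Fin n → ℕ}
    (c : Fin n → (∀ i, A i) → ℝ)
    (g : ∀ i, Fin (d i) → EuclideanSpace ℝ (A i) → ℝ)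
    (Φ : ConstrainedPotentialGame.Profile A → ℝ)
    (hΦ : ConstrainedPotentialGame.IsPotential c Φ)
    (γ : ℝ) (hγ : 0 < γ)
    (hconv : ∀ i m, ConvexOn ℝ (ConstrainedPotentialGame.simplex (A i)) (g i m))
    (hsmooth : ∀ i m, ConstrainedPotentialGame.IsSmoothOnSimplex γ (g i m))
    (hslater : ConstrainedPotentialGame.Slater g)
    (a b : ℝ) (ha : 0 < a) :
    ∃ K : ℝ, 0 < K ∧ ∃ ε₀ : ℝ, 0 < ε₀ ∧ ∃ T : ℝ → ℕ,
      ∀ ε : ℝ, 0 < ε → ε ≤ ε₀ →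
        (T ε : ℝ) ≤ K / ε ^ 6 ∧
        ∀ μ : ℝ, a * ε ≤ μ → μ ≤ b * ε →
          ∀ (x : ℕ → ConstrainedPotentialGame.Profile A)
            (lam : ℕ → ConstrainedPotentialGame.Multiplier d),
            ConstrainedPotentialGame.IsIGDRun c g μ
              (ConstrainedPotentialGame.stepSize g γ μ) x lam →
            ∃ t : ℕ, 1 ≤ t ∧ t ≤ T ε ∧
              ConstrainedPotentialGame.IsApproxFeasibleApproxNash c g ε (K * ε) (x t) := by
  rcases n.eq_zero_or_pos with rfl | hn
  · refine ⟨1, one_pos, 1, one_pos, fun _ => 1, fun ε hε hε1 => ⟨?_, ?_⟩⟩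
    · rw [Nat.cast_one]
      exact (one_le_div (by positivity)).2 (pow_le_one₀ hε.le hε1)
    · exact fun μ _ _ x lam _ => ⟨1, le_rfl, le_rfl, fun i => i.elim0, fun i => i.elim0,
        fun i => i.elim0⟩
  obtain ⟨ξ, hξ, hmargin⟩ := hslater.exists_margin
  have hne : ∀ i, Nonempty (A i) := fun i => by
    obtain ⟨y, hy, -⟩ := hmargin i
    by_contra h
    rw [not_nonempty_iff] at h
    simpa using hy.2
  have hN : 1 ≤ (n : ℝ) * maxActions A := one_le_mul_maxActions hn
  have hC := totalCost_nonneg c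
  -- Bounds for the gradients and for the values of the constraints.
  obtain ⟨B, hB⟩ : ∃ B : ℝ, ∀ i m, ∀ y ∈ simplex (A i), ‖gradient (g i m) y‖ ≤ B := by
    choose β hβ0 hβ using fun i m => (hsmooth i m).exists_gradient_bound hγ
    refine ⟨∑ i, ∑ m, β i m, fun i m y hy => (hβ i m y hy).trans ?_⟩
    exact (Finset.single_le_sum (f := fun m => β i m) (fun m _ => hβ0 i m)
      (Finset.mem_univ m)).trans
      (Finset.single_le_sum (f := fun i => ∑ m, β i m)
        (fun i _ => Finset.sum_nonneg fun m _ => hβ0 i m) (Finset.mem_univ i))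
  have hbdd : BddAbove {r | ∃ i m, ∃ y ∈ simplex (A i), g i m y = r} := by
    refine ⟨-ξ + |B| * 2, ?_⟩
    rintro _ ⟨i, m, y, hy, rfl⟩
    obtain ⟨z, hz, hgz⟩ := hmargin i
    have h1 := le_of_abs_le (abs_sub_le_of_gradient_bound (hconv i m) (hsmooth i m)
      (fun u hu => (hB i m u hu).trans (le_abs_self B)) hz hy)
    have h2 := mul_le_mul_of_nonneg_left (norm_sub_le_two hy hz) (abs_nonneg B)
    linarith [hgz m]
  set G := max (constraintMax g) 0
  have hG0 : 0 ≤ G := le_max_right _ _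
  have hG : ∀ i m, ∀ y ∈ simplex (A i), max (g i m y) 0 ≤ G := fun i m y hy =>
    max_le_max (le_csSup hbdd ⟨i, m, y, hy, rfl⟩) le_rfl
  obtain ⟨Q, hQ0, hQG, hQ⟩ := exists_penalty_le_add hγ hconv hsmooth hB hG0 hG
  have hcase : Q / 4 = 0 ∨ 0 < Real.sqrt (∑ i, (d i : ℝ)) * constraintMax g := by
    rcases le_or_gt (constraintMax g) 0 with h | h
    · left; rw [hQG (max_eq_right h), zero_div]
    · right
      refine mul_pos (Real.sqrt_pos.2 ?_) h
      -- Without constraints the supremum defining `constraintMax` is that of the empty set.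
      by_contra hd
      have hd0 : ∀ i, d i = 0 := by
        have := le_antisymm (not_lt.1 hd) (Finset.sum_nonneg fun i _ => Nat.cast_nonneg (d i))
        intro i
        exact_mod_cast (Finset.sum_eq_zero_iff_of_nonneg fun i _ => Nat.cast_nonneg (d i)).1
          this i (Finset.mem_univ i)
      have he : {r | ∃ i m, ∃ y ∈ simplex (A i), g i m y = r} = ∅ := by
        refine Set.eq_empty_of_forall_notMem ?_
        rintro _ ⟨i, m, -⟩
        exact (Fin.cast (hd0 i) m).elim0
      rw [constraintMax, he, Real.sSup_empty] at h
      exact h.false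
  obtain ⟨μ₀, hμ₀, hμ₀1, hη⟩ := exists_stepSize_mul_le (g := g) hγ
    (show 0 ≤ totalCost c * n by positivity) (show 0 ≤ Q / 4 by positivity) hN hcase
  obtain ⟨σ, hσ, hη3⟩ := exists_mul_pow_le_stepSize (g := g) γ hN
  obtain ⟨R, hR0, hR⟩ := hΦ.exists_sub_le
  set P := ∑ i, ∑ _m : Fin (d i), G ^ 2
  have hP0 : 0 ≤ P := by positivity
  set κ := totalCost c + ∑ i, ∑ _m : Fin (d i), G * |B|
  have hκ0 : 0 ≤ κ := by positivity
  set K₁ := 2 * (R + P + 1) / (σ * a ^ 4) with hK₁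
  have hK₁0 : 0 < K₁ := by positivity
  set Λ := (totalCost c * 2 + (2 + κ)) / ξ with hΛ
  have hΛ0 : 0 ≤ Λ := by positivity
  refine ⟨K₁ + 1 + (2 + κ) + Λ + 2 * |b| * Λ, by positivity, min 1 (μ₀ / (|b| + 1)),
    by positivity, fun ε => ⌈K₁ / ε ^ 6⌉₊, fun ε hε hε₀ => ⟨?_, ?_⟩⟩
  · have hε1 : ε ≤ 1 := hε₀.trans (min_le_left _ _)
    have h1 : 1 ≤ 1 / ε ^ 6 := (one_le_div (by positivity)).2 (pow_le_one₀ hε.le hε1)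
    calc (⌈K₁ / ε ^ 6⌉₊ : ℝ) ≤ K₁ / ε ^ 6 + 1 := (Nat.ceil_lt_add_one (by positivity)).le
      _ ≤ K₁ / ε ^ 6 + 1 / ε ^ 6 := by gcongr
      _ = (K₁ + 1) / ε ^ 6 := by rw [add_div]
      _ ≤ _ := by
        have : 0 ≤ 2 * |b| * Λ := by positivity
        exact div_le_div_of_nonneg_right (by linarith) (by positivity)
  · intro μ haμ hμb x lam hrun
    have hε1 : ε ≤ 1 := hε₀.trans (min_le_left _ _)
    have hμ : 0 < μ := (mul_pos ha hε).trans_le haμ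
    have hμb' : μ ≤ |b| * ε := hμb.trans (mul_le_mul_of_nonneg_right (le_abs_self b) hε.le)
    have hμμ₀ : μ ≤ μ₀ := by
      have := (le_div_iff₀ (by positivity)).1 (hε₀.trans (min_le_right _ _))
      nlinarith
    have hμ1 : μ ≤ 1 := hμμ₀.trans hμ₀1
    have hηpos : 0 < stepSize g γ μ := stepSize_pos hμ hN
    have hημ : stepSize g γ μ ≤ μ := (stepSize_le hμ hN).trans (by linarith)
    have hηlow := hη3 μ hμ hμ1
    have hηcurv := hη μ hμ hμμ₀
    set η := stepSize g γ μ
    have hT : 0 < ⌈K₁ / ε ^ 6⌉₊ := Nat.ceil_pos.2 (by positivity)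
    have hmix := hrun.mem_mixedProfiles
    have hosc : η * (Φ (x 1) + penalty g (x 1) / (4 * μ))
        - η * (Φ (x (⌈K₁ / ε ^ 6⌉₊ + 1)) + penalty g (x (⌈K₁ / ε ^ 6⌉₊ + 1)) / (4 * μ))
        ≤ η * ((R + P) / μ) := by
      have h1 := hR _ (hmix (⌈K₁ / ε ^ 6⌉₊ + 1)) _ (hmix 1)
      have h2 : penalty g (x 1) / (4 * μ) ≤ P / μ :=
        div_le_div₀ hP0 (penalty_le hG (hmix 1)) hμ (by linarith)
      have h3 : 0 ≤ penalty g (x (⌈K₁ / ε ^ 6⌉₊ + 1)) / (4 * μ) :=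
        div_nonneg (penalty_nonneg _) (by positivity)
      have h4 : R ≤ R / μ := (le_div_iff₀ hμ).2 (mul_le_of_le_one_right hR0 hμ1)
      rw [← mul_sub, add_div]
      exact mul_le_mul_of_nonneg_left (by linarith) hηpos.le
    -- The step size is at least `σ μ ^ 3` and `μ ≥ a ε`, so `1 / ε ^ 6` steps suffice.
    have hmany : 2 * (η * ((R + P) / μ)) ≤ ⌈K₁ / ε ^ 6⌉₊ * (η * ε) ^ 2 := by
      have h1 : (a * ε) ^ 4 ≤ μ ^ 4 := pow_le_pow_left₀ (by positivity) haμ 4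
      have h2 : 2 * ((R + P) / μ) ≤ K₁ / ε ^ 6 * (σ * μ ^ 3 * ε ^ 2) := by
        have e : K₁ / ε ^ 6 * (σ * μ ^ 3 * ε ^ 2) = 2 * (R + P + 1) * μ ^ 4 / ((a * ε) ^ 4 * μ) := by
          rw [hK₁]; field_simp
        rw [e, ← mul_div_assoc, div_le_div_iff₀ hμ (by positivity)]
        have h3 : 2 * (R + P) * (a * ε) ^ 4 ≤ 2 * (R + P + 1) * μ ^ 4 :=
          mul_le_mul (by linarith) h1 (by positivity) (by positivity)
        nlinarith
      calc 2 * (η * ((R + P) / μ)) = η * (2 * ((R + P) / μ)) := by ring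
        _ ≤ η * (K₁ / ε ^ 6 * (σ * μ ^ 3 * ε ^ 2)) := by gcongr
        _ ≤ η * (⌈K₁ / ε ^ 6⌉₊ * (η * ε ^ 2)) := by
          gcongr
          exact Nat.le_ceil _
        _ = _ := by ring
    obtain ⟨t, ht1, htT, hshort⟩ := exists_le_of_descent
      (Ψ := fun t => η * (Φ (x t) + penalty g (x t) / (4 * μ)))
      (s := fun t => ∑ i, ‖x (t + 1) i - x t i‖ ^ 2) hT
      (hrun.descent hμ hηpos hΦ hQ hηcurv) hosc hmany
    have hlam := fun i m => multiplier_eq_of_isMaxOn hμ (hrun.lam_mem t) (hrun.lam_max t) i m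
    have hlam0 := fun i m => hrun.lam_mem t i m
    have hcompl : ∀ i m, 0 ≤ lam t i m * g i m (x t i) := by
      intro i m
      rcases le_total (g i m (x t i)) 0 with h | h
      · rw [hlam, max_eq_right h]; simp
      · exact mul_nonneg (hlam0 i m) h
    have hdiff : ∀ i m, DifferentiableAt ℝ (g i m) (x t i) := fun i m =>
      (hsmooth i m).1 _ (hmix t i)
    have hstat : ∀ i, ∀ y ∈ simplex (A i),
        -((2 + κ) * ε) ≤ inner ℝ (playerGradient c g (x t) (lam t) i) (y - x t i) := by
      intro i y hy
      refine IsProjection.neg_le_inner hηpos hκ0 (fun w => mul_abs_inner_playerGradient_le hμ hμ1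
        hημ hG0 hB hG (hmix t) hlam i w) (hrun.step t i) ?_ hy
      refine (sq_le_sq₀ (norm_nonneg _) (by positivity)).1 (le_trans ?_ hshort)
      exact Finset.single_le_sum (f := fun i => ‖x (t + 1) i - x t i‖ ^ 2)
        (fun _ _ => by positivity) (Finset.mem_univ i)
    have hsum : ∀ i, ∑ m, lam t i m ≤ Λ := by
      intro i
      obtain ⟨z, hz, hgz⟩ := hmargin i
      refine (sum_multiplier_le (hmix t) hξ (hconv i) (hdiff i) (hlam0 i) (hcompl i) hz hgz
        (hstat i z hz)).trans ?_
      rw [hΛ]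
      gcongr
      exact mul_le_of_le_one_right (by positivity) hε1
    refine ⟨t, ht1, htT, hmix t, fun i m => ?_, fun i y hy hgy => ?_⟩
    · have h1 : lam t i m ≤ Λ := (Finset.single_le_sum (f := fun m => lam t i m)
        (fun m _ => hlam0 i m) (Finset.mem_univ m)).trans (hsum i)
      have h2 : max (g i m (x t i)) 0 = 2 * μ * lam t i m := by rw [hlam]; field_simp
      calc g i m (x t i) ≤ 2 * μ * lam t i m := h2 ▸ le_max_left _ _
        _ ≤ 2 * (|b| * ε) * Λ := mul_le_mul (by linarith) h1 (hlam0 i m) (by positivity)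
        _ = 2 * |b| * Λ * ε := by ring
        _ ≤ _ := mul_le_mul_of_nonneg_right (by linarith) hε.le
    · refine le_trans (sub_le_sub_left ?_ _) (expectedCost_sub_le_update (hmix t) (hconv i)
        (hdiff i) (hlam0 i) (hcompl i) hy hgy (hstat i y hy))
      rw [← add_mul]
      have : 0 ≤ 2 * |b| * Λ := by positivity
      exact mul_le_mul_of_nonneg_right (by linarith [hsum i]) hε.le
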